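/- Let $\mathrm{TO}(n)$ be the group of $n\times n$ matrices $A$ over $\mathbb F_2$ with $A^TA=I_n$. An involution is an element $A$ with $A^2=I_n$ (the identity is included). For a matrix $A$ over $\mathbb F_2$ let $m(A)$, the mirror of $A$, be the matrix obtained by changing every entry ($0\leftrightarrow 1$); for even $n$ the mirror of an involution in $\mathrm{TO}(n)$ is again an involution in $\mathrm{TO}(n)$. For an involution $A\in\mathrm{TO}(n)$ put $D(A)=\operatorname{rank}(A+I_n)$, let $\alpha(A)\in\{0,1\}$ be the rank of the linear map $\mathbb F_2^n\to\mathbb F_2$, $v\mapsto v\cdot Av$, and, for $n$ even, let $$DD(A)=[D(A),\,\alpha(A),\,D(m(A)),\,\alpha(m(A))]\in\mathbb Z^4 .$$ Let $A\oplus B$ denote the block diagonal sum, $A^{\oplus k}$ the $k$-fold sum, $I=\begin{bmatrix}1&0\\0&1\end{bmatrix}$ and $J=\begin{bmatrix}0&1\\1&0\end{bmatrix}$. (a) Let $n$ be even. Two involutions $A$ and $B$ in $\mathrm{TO}(n)$ are conjugate in $\mathrm{TO}(n)$ if and only if $DD(A)=DD(B)$. (b) For every $n\ge 2$ there are precisely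 $5n-4$ conjugacy classes of involutions in $\mathrm{TO}(2n)$. For every $n\ge 1$ the following matrices are involutions in $\mathrm{TO}(2n)$, and every involution in $\mathrm{TO}(2n)$ is conjugate in $\mathrm{TO}(2n)$ to exactly one of them: - $I^{\oplus(n-k)}\oplus J^{\oplus k}$ for $1\le k\le n-1$, together with their mirrors; - $m(I^{\oplus(n-k)})\oplus J^{\oplus k}$ for $0\le k\le n-1$, together with their mirrors; - $m\bigl(I^{\oplus(n-k-1)}\oplus J^{\oplus k}\bigr)\oplus J$ for $1\le k\le n-2$. -/

import Mathlib

namespace TopOrth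

open Matrix

/-- Square matrices of size `n` over the field with two elements. -/
abbrev Mat (n : ℕ) : Type := Matrix (Fin n) (Fin n) (ZMod 2)

/-- The group of `n × n` matrices `A` over `𝔽₂` with `Aᵀ A = 1`. -/
abbrev TO (n : ℕ) : Type := Matrix.orthogonalGroup (Fin n) (ZMod 2)

/-- Membership in Mathlib's orthogonal group over `𝔽₂` is the equation `Aᵀ A = 1`. -/
theorem mem_TO_iff {n : ℕ} (A : Mat n) :
    A ∈ Matrix.orthogonalGroup (Fin n) (ZMod 2) ↔ Aᵀ * A = 1 := by
  rw [Matrix.mem_orthogonalGroup_iff']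

/-- An involution is an element whose square is the identity; the identity itself counts. -/
def IsInvolution {n : ℕ} (A : TO n) : Prop := A * A = 1

/-- The mirror of a matrix over `𝔽₂`: every entry is changed. -/
def mirror {n : ℕ} (A : Mat n) : Mat n := Matrix.of fun i j => A i j + 1

/-- The invariant `D(A) = rank (A + 1)`. -/
noncomputable def D {n : ℕ} (A : Mat n) : ℕ := (A + 1).rank

/-- The invariant `α(A)`: the rank of the map `v ↦ v ⬝ A v` from `𝔽₂ⁿ` to `𝔽₂`, that is, the
dimension of the space spanned by its values.  For an involution in `TO n` the map is linear
(see `exists_linear_alpha`), so this is its rank as a linear map. -/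
noncomputable def alpha {n : ℕ} (A : Mat n) : ℕ :=
  Module.finrank (ZMod 2)
    (Submodule.span (ZMod 2) (Set.range fun v : Fin n → ZMod 2 => v ⬝ᵥ (A *ᵥ v)))

/-- For an involution in `TO n`, the map `v ↦ v ⬝ A v` is linear and `alpha` is its rank. -/
theorem exists_linear_alpha {n : ℕ} (A : TO n) (hA : IsInvolution A) :
    ∃ L : (Fin n → ZMod 2) →ₗ[ZMod 2] ZMod 2,
      (∀ v, L v = v ⬝ᵥ ((A : Mat n) *ᵥ v)) ∧
        alpha (A : Mat n) = Module.finrank (ZMod 2) (LinearMap.range L) := by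
  have h1 : (A : Mat n)ᵀ * (A : Mat n) = 1 := (mem_TO_iff _).1 A.2
  have h2 : (A : Mat n) * (A : Mat n) = 1 := congrArg Subtype.val hA
  have hs : (A : Mat n)ᵀ = (A : Mat n) := by
    calc (A : Mat n)ᵀ = (A : Mat n)ᵀ * ((A : Mat n) * (A : Mat n)) := by rw [h2, mul_one]
      _ = (A : Mat n) := by rw [← mul_assoc, h1, one_mul]
  have hsym : ∀ v w : Fin n → ZMod 2,
      w ⬝ᵥ ((A : Mat n) *ᵥ v) = v ⬝ᵥ ((A : Mat n) *ᵥ w) := by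
    intro v w
    rw [dotProduct_mulVec, ← mulVec_transpose, hs, dotProduct_comm]
  let L : (Fin n → ZMod 2) →ₗ[ZMod 2] ZMod 2 :=
    { toFun := fun v => v ⬝ᵥ ((A : Mat n) *ᵥ v)
      map_add' := fun v w => by
        have h := CharTwo.add_self_eq_zero (v ⬝ᵥ ((A : Mat n) *ᵥ w))
        simp only [mulVec_add, add_dotProduct, dotProduct_add, hsym v w]
        linear_combination h
      map_smul' := fun c v => by
        have hc : c * c = c := by revert c; decide
        simp only [mulVec_smul, smul_dotProduct, dotProduct_smul, smul_eq_mul, RingHom.id_apply]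
        rw [← mul_assoc, hc] }
  refine ⟨L, fun v => rfl, ?_⟩
  have : Submodule.span (ZMod 2) (Set.range fun v : Fin n → ZMod 2 => v ⬝ᵥ ((A : Mat n) *ᵥ v))
      = LinearMap.range L :=
    Submodule.span_eq (LinearMap.range L)
  unfold alpha
  rw [this]

/-- The double-Dickson invariant `[D(A), α(A), D(m A), α(m A)]`. -/
noncomputable def DD {n : ℕ} (A : Mat n) : Fin 4 → ℤ :=
  ![(D A : ℤ), (alpha A : ℤ), (D (mirror A) : ℤ), (alpha (mirror A) : ℤ)]

/-- The block diagonal sum `A ⊕ B`, with `A` in the upper left corner. -/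
def dsum {a b : ℕ} (A : Mat a) (B : Mat b) : Mat (a + b) :=
  Matrix.reindex finSumFinEquiv finSumFinEquiv (Matrix.fromBlocks A 0 0 B)

/-- The `k`-fold block diagonal sum of a `2 × 2` matrix with itself. -/
def dpow (A : Mat 2) : (k : ℕ) → Mat (2 * k)
  | 0 => 0
  | k + 1 => dsum (dpow A k) A

/-- Rewrites the size of a matrix along an equality of sizes. -/
def resize {a b : ℕ} (h : a = b) (A : Mat a) : Mat b :=
  Matrix.reindex (finCongr h) (finCongr h) A

/-- The `2 × 2` identity matrix. -/
def I₂ : Mat 2 := !![1, 0; 0, 1]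

/-- The `2 × 2` matrix that interchanges the two coordinates. -/
def J₂ : Mat 2 := !![0, 1; 1, 0]

/-- `I^{⊕(n-k)} ⊕ J^{⊕k}`. -/
def family1 (n k : ℕ) (h : k ≤ n) : Mat (2 * n) :=
  resize (show 2 * (n - k) + 2 * k = 2 * n by omega) (dsum (dpow I₂ (n - k)) (dpow J₂ k))

/-- `m(I^{⊕(n-k)}) ⊕ J^{⊕k}`. -/
def family2 (n k : ℕ) (h : k ≤ n) : Mat (2 * n) :=
  resize (show 2 * (n - k) + 2 * k = 2 * n by omega)
    (dsum (mirror (dpow I₂ (n - k))) (dpow J₂ k))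

/-- `m(I^{⊕(n-k-1)} ⊕ J^{⊕k}) ⊕ J`. -/
def family3 (n k : ℕ) (h : k + 1 ≤ n) : Mat (2 * n) :=
  resize (show 2 * (n - k - 1) + 2 * k + 2 = 2 * n by omega)
    (dsum (mirror (dsum (dpow I₂ (n - k - 1)) (dpow J₂ k))) J₂)

/-- Labels for the listed matrices of size `2n`.  The ranges of `k` are `1 ≤ k ≤ n - 1`,
`0 ≤ k ≤ n - 1` and `1 ≤ k ≤ n - 2` (as integers); the constructors with `Mirror` stand for the
mirrors of the members of the first two families. -/
inductive RepIndex (n : ℕ) : Type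
  | first (k : ℕ) (h₁ : 1 ≤ k) (h₂ : k + 1 ≤ n)
  | firstMirror (k : ℕ) (h₁ : 1 ≤ k) (h₂ : k + 1 ≤ n)
  | second (k : ℕ) (h : k + 1 ≤ n)
  | secondMirror (k : ℕ) (h : k + 1 ≤ n)
  | third (k : ℕ) (h₁ : 1 ≤ k) (h₂ : k + 2 ≤ n)

/-- The matrix with a given label. -/
def rep {n : ℕ} : RepIndex n → Mat (2 * n)
  | .first k _ h₂ => family1 n k (by omega)
  | .firstMirror k _ h₂ => mirror (family1 n k (by omega))
  | .second k h => family2 n k (by omega)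
  | .secondMirror k h => mirror (family2 n k (by omega))
  | .third k _ h₂ => family3 n k (by omega)

/-- The set of conjugacy classes of involutions in `TO n`. -/
def involutionClasses (n : ℕ) : Set (ConjClasses (TO n)) :=
  {c | ∃ A : TO n, IsInvolution A ∧ ConjClasses.mk A = c}

end TopOrth

namespace TopOrth

open Matrix

/-! An involution `A` in the group is a symmetric matrix with `(A + 1)² = 0`. Because `v ⬝ v = v ⬝
1` over `𝔽₂`, every orthogonal matrix fixes the all-one vector `1`, and this is the only extra
obstruction in Witt's theorem (`exists_TO_mul`).

Unless the diagonal of `A` is constantly `1`, Albert's theorem (`exists_eq_mul_transpose`) gives `A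
+ 1 = X Xᵀ` with independent columns, and `(A + 1)² = 0` forces `Xᵀ X = 0`. By Witt, the class of
`A` is then determined by `D A` and by the solution `c` of `X c = 1`, if there is one. Replacing `X`
by `X h` with `h` orthogonal moves `c` within its orbit, which for `c ≠ 0` depends only on `c ⬝ c`
and on whether `c = 1` (`exists_TO_mulVec`). The invariants record exactly this: `D (mirror A) - D
A` is `1`, `0` or `-1` according as `c` does not exist, `c ⬝ c = 0` or `c ⬝ c = 1`, and `c = 1`
means `alpha A = 0`. If the diagonal is constantly `1`, which for even `n` means `alpha (mirror A) =
0`, the argument applies to the mirror when `n > 0`. This proves (a).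

For (b), the same trichotomy with `D ≤ n` limits the possible values of `DD`
(`exists_repInvariants_eq`). The listed block sums realize each of them once (`invariants_rep`,
`repInvariants_injective`), so counting classes is counting labels. -/

/-- Over `𝔽₂`, the square of a vector is its product with the all-one vector. -/
theorem dotProduct_self_eq {n : ℕ} (v : Fin n → ZMod 2) : v ⬝ᵥ v = v ⬝ᵥ 1 := by
  have h : ∀ c : ZMod 2, c * c = c := by decide
  simp [dotProduct, h]

/-! ### Transvections and Witt's extension theorem -/

theorem transvection_mulVec {n : ℕ} (a x : Fin n → ZMod 2) :
    (1 + vecMulVec a a) *ᵥ x = x + (a ⬝ᵥ x) • a := by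
  rw [add_mulVec, one_mulVec, vecMulVec_mulVec]
  simp

theorem transvection_mem {n : ℕ} {a : Fin n → ZMod 2} (ha : a ⬝ᵥ a = 0) :
    1 + vecMulVec a a ∈ Matrix.orthogonalGroup (Fin n) (ZMod 2) := by
  have h2 : vecMulVec a a * vecMulVec a a = 0 := by
    rw [vecMulVec_mul_vecMulVec, ha]; simp
  rw [mem_TO_iff, transpose_add, transpose_one, transpose_vecMulVec, add_mul, mul_add, mul_add, h2]
  simp only [one_mul, mul_one, add_zero]
  rw [add_assoc, ZModModule.add_self, add_zero]

/-- A linear form given by a dot product separates a vector from a subspace. -/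
theorem exists_dotProduct_eq_one {n : ℕ} (W : Submodule (ZMod 2) (Fin n → ZMod 2))
    {x : Fin n → ZMod 2} (hx : x ∉ W) : ∃ t, (∀ w ∈ W, t ⬝ᵥ w = 0) ∧ t ⬝ᵥ x = 1 := by
  obtain ⟨f, hf, hW⟩ := Submodule.exists_le_ker_of_notMem hx
  have key : ∀ v, (fun i => f (Pi.single i 1)) ⬝ᵥ v = f v := by
    intro v
    conv_rhs => rw [pi_eq_sum_univ' v]
    simp [dotProduct, mul_comm]
  refine ⟨fun i => f (Pi.single i 1), fun w hw => by rw [key]; exact hW hw, ?_⟩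
  rw [key]
  have h : ∀ c : ZMod 2, c ≠ 0 → c = 1 := by decide
  exact h _ hf

/-- One of `s`, `t`, `s + t` works, where `s` separates `x` and `t` separates `y`: a vector space is
not the union of two proper subspaces. -/
theorem exists_dotProduct_eq_one_of_two {n : ℕ} (W : Submodule (ZMod 2) (Fin n → ZMod 2))
    {x y : Fin n → ZMod 2} (hx : x ∉ W) (hy : y ∉ W) :
    ∃ t, (∀ w ∈ W, t ⬝ᵥ w = 0) ∧ t ⬝ᵥ x = 1 ∧ t ⬝ᵥ y = 1 := by
  obtain ⟨s, hs, hsx⟩ := exists_dotProduct_eq_one W hx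
  obtain ⟨t, ht, hty⟩ := exists_dotProduct_eq_one W hy
  have h : ∀ c : ZMod 2, c = 0 ∨ c = 1 := by decide
  rcases h (s ⬝ᵥ y) with h1 | h1
  · rcases h (t ⬝ᵥ x) with h2 | h2
    · refine ⟨s + t, fun w hw => ?_, ?_, ?_⟩
      · rw [add_dotProduct, hs w hw, ht w hw, add_zero]
      · rw [add_dotProduct, hsx, h2, add_zero]
      · rw [add_dotProduct, h1, hty, zero_add]
    · exact ⟨t, ht, h2, hty⟩
  · exact ⟨s, hs, hsx, h1⟩

/-- If `x + y` pairs to `1` with `x`, a transvection sends `x` to `y`. -/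
theorem exists_transvection {n : ℕ} (W : Submodule (ZMod 2) (Fin n → ZMod 2)) (h1 : 1 ∈ W)
    {x y : Fin n → ZMod 2} (hW : ∀ w ∈ W, x ⬝ᵥ w = y ⬝ᵥ w) (hxy : (x + y) ⬝ᵥ x = 1) :
    ∃ g ∈ Matrix.orthogonalGroup (Fin n) (ZMod 2), g *ᵥ x = y ∧ ∀ w ∈ W, g *ᵥ w = w := by
  have hw0 : ∀ w ∈ W, (x + y) ⬝ᵥ w = 0 := fun w hw => by
    rw [add_dotProduct, hW w hw, CharTwo.add_self_eq_zero]
  refine ⟨1 + vecMulVec (x + y) (x + y), transvection_mem ?_, ?_, fun w hw => ?_⟩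
  · rw [dotProduct_self_eq]; exact hw0 1 h1
  · rw [transvection_mulVec, hxy, one_smul, ← add_assoc, ZModModule.add_self, zero_add]
  · rw [transvection_mulVec, hw0 w hw, zero_smul, add_zero]

/-- This is the one-vector step of Witt's theorem. If the direct transvection along `x + y` fails,
two transvections through an intermediate vector `x + t` succeed, with `t` orthogonal to `W` and
pairing to `1` with both `x` and `y`. -/
theorem exists_TO_fixing {n : ℕ} (W : Submodule (ZMod 2) (Fin n → ZMod 2)) (h1 : 1 ∈ W)
    {x y : Fin n → ZMod 2} (hx : x ∉ W) (hy : y ∉ W) (hW : ∀ w ∈ W, x ⬝ᵥ w = y ⬝ᵥ w) :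
    ∃ g ∈ Matrix.orthogonalGroup (Fin n) (ZMod 2), g *ᵥ x = y ∧ ∀ w ∈ W, g *ᵥ w = w := by
  have h : ∀ c : ZMod 2, c = 0 ∨ c = 1 := by decide
  rcases h ((x + y) ⬝ᵥ x) with h0 | h0
  · obtain ⟨t, htW, htx, hty⟩ := exists_dotProduct_eq_one_of_two W hx hy
    have hzW : ∀ w ∈ W, x ⬝ᵥ w = (x + t) ⬝ᵥ w := fun w hw => by
      rw [add_dotProduct, htW w hw, add_zero]
    obtain ⟨g, hg, hgx, hgW⟩ := exists_transvection W h1 hzW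
      (by rw [← add_assoc, ZModModule.add_self, zero_add, htx])
    obtain ⟨g', hg', hgx', hgW'⟩ := exists_transvection W h1
      (fun w hw => (hzW w hw).symm.trans (hW w hw))
      (show (x + t + y) ⬝ᵥ (x + t) = 1 by
        have htt : t ⬝ᵥ t = 0 := by rw [dotProduct_self_eq]; exact htW 1 h1
        simp only [add_dotProduct, dotProduct_add] at h0 ⊢
        rw [htt, dotProduct_comm x t, dotProduct_comm y t, htx, hty]
        have h2 : (1 : ZMod 2) + 1 = 0 := by decide
        linear_combination h0 + h2)
    refine ⟨g' * g, mul_mem hg' hg, ?_, fun w hw => ?_⟩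
    · rw [← mulVec_mulVec, hgx, hgx']
    · rw [← mulVec_mulVec, hgW w hw, hgW' w hw]
  · exact exists_transvection W h1 hW h0

theorem TO_transpose_mul {n : ℕ} {g : Mat n} (hg : g ∈ Matrix.orthogonalGroup (Fin n) (ZMod 2)) :
    gᵀ * g = 1 := (mem_TO_iff g).1 hg

theorem TO_mul_transpose {n : ℕ} {g : Mat n} (hg : g ∈ Matrix.orthogonalGroup (Fin n) (ZMod 2)) :
    g * gᵀ = 1 := mul_eq_one_comm.1 (TO_transpose_mul hg)

theorem TO_dotProduct {n : ℕ} {g : Mat n} (hg : g ∈ Matrix.orthogonalGroup (Fin n) (ZMod 2))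
    (v w : Fin n → ZMod 2) : (g *ᵥ v) ⬝ᵥ (g *ᵥ w) = v ⬝ᵥ w := by
  rw [dotProduct_mulVec, vecMul_mulVec, ← dotProduct_mulVec,
    TO_transpose_mul hg, one_mulVec]

/-- The all-one vector is fixed by the orthogonal group. -/
theorem TO_mulVec_one {n : ℕ} {g : Mat n} (hg : g ∈ Matrix.orthogonalGroup (Fin n) (ZMod 2)) :
    g *ᵥ 1 = 1 := by
  have key : gᵀ *ᵥ 1 = 1 := by
    refine dotProduct_eq _ _ fun v => ?_
    rw [mulVec_transpose, ← dotProduct_mulVec, dotProduct_comm, ← dotProduct_self_eq,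
      TO_dotProduct hg, dotProduct_self_eq, dotProduct_comm]
  calc g *ᵥ 1 = g *ᵥ (gᵀ *ᵥ 1) := by rw [key]
    _ = 1 := by rw [mulVec_mulVec, TO_mul_transpose hg, one_mulVec]

/-- Witt's extension theorem for the dot product over `𝔽₂`: two families with the same Gram matrix
and the same linear relations modulo the all-one vector are in one orbit. -/
theorem exists_TO_family {n : ℕ} : ∀ (k : ℕ) (x y : Fin k → Fin n → ZMod 2),
    (∀ i j, x i ⬝ᵥ x j = y i ⬝ᵥ y j) →
    (∀ (c : Fin k → ZMod 2) (e : ZMod 2), ∑ i, c i • x i = e • 1 ↔ ∑ i, c i • y i = e • 1) →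
    ∃ g ∈ Matrix.orthogonalGroup (Fin n) (ZMod 2), ∀ i, g *ᵥ x i = y i := by
  intro k
  induction k with
  | zero => exact fun x y _ _ => ⟨1, one_mem _, fun i => i.elim0⟩
  | succ k ih =>
    intro x y hG hR
    obtain ⟨g, hg, hgx⟩ := ih (fun i => x i.succ) (fun i => y i.succ) (fun i j => hG _ _) (by
      intro c e
      have := hR (Fin.cons 0 c) e
      simpa [Fin.sum_univ_succ] using this)
    set W : Submodule (ZMod 2) (Fin n → ZMod 2) :=
      Submodule.span (ZMod 2) (insert 1 (Set.range fun i : Fin k => y i.succ)) with hWdef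
    have h1W : (1 : Fin n → ZMod 2) ∈ W := Submodule.subset_span (Set.mem_insert _ _)
    have hmem : ∀ z, z ∈ W ↔ ∃ (c : Fin k → ZMod 2) (e : ZMod 2),
        z + ∑ i, c i • y i.succ = e • 1 := by
      intro z
      rw [hWdef, Submodule.mem_span_insert]
      constructor
      · rintro ⟨e, w, hw, rfl⟩
        obtain ⟨c, rfl⟩ := (Submodule.mem_span_range_iff_exists_fun _).1 hw
        exact ⟨c, e, by rw [add_assoc, ZModModule.add_self, add_zero]⟩
      · rintro ⟨c, e, h⟩
        refine ⟨e, _, (Submodule.mem_span_range_iff_exists_fun _).2 ⟨c, rfl⟩, ?_⟩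
        rw [← h, add_assoc, ZModModule.add_self, add_zero]
    -- The map `g` is injective and fixes `1`, so it carries relations among the `x i` to relations
    -- among their images; only those with coefficient `1` at the new vector matter.
    have hiff : ∀ (c : Fin k → ZMod 2) (e : ZMod 2),
        g *ᵥ x 0 + ∑ i, c i • y i.succ = e • 1 ↔ y 0 + ∑ i, c i • y i.succ = e • 1 := by
      intro c e
      have h := hR (Fin.cons 1 c) e
      simp only [Fin.sum_univ_succ, Fin.cons_zero, Fin.cons_succ, one_smul] at h
      rw [← h]
      have hinj : Function.Injective (g *ᵥ ·) := fun a b hab => by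
        have := congrArg (gᵀ *ᵥ ·) hab
        simpa [mulVec_mulVec, TO_transpose_mul hg] using this
      have h' := hinj.eq_iff (a := x 0 + ∑ i, c i • x i.succ) (b := e • 1)
      simp only [mulVec_add, mulVec_smul, mulVec_sum, hgx, TO_mulVec_one hg] at h'
      exact h'
    -- Inside `W`, the shared relation already forces `g *ᵥ x 0 = y 0`; outside, a further map
    -- fixing `W` corrects the image.
    by_cases hx : g *ᵥ x 0 ∈ W
    · obtain ⟨c, e, h⟩ := (hmem _).1 hx
      have h' := (hiff c e).1 h
      refine ⟨g, hg, fun i => ?_⟩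
      refine Fin.cases ?_ hgx i
      exact add_right_cancel (h.trans h'.symm)
    · have hy : y 0 ∉ W := fun hy => by
        obtain ⟨c, e, h⟩ := (hmem _).1 hy
        exact hx ((hmem _).2 ⟨c, e, (hiff c e).2 h⟩)
      obtain ⟨g', hg', hgx', hgW'⟩ := exists_TO_fixing W h1W hx hy (by
        intro w hw
        induction hw using Submodule.span_induction with
        | mem w hw =>
          rcases hw with rfl | ⟨i, rfl⟩
          · rw [← dotProduct_self_eq, ← dotProduct_self_eq, TO_dotProduct hg, hG]
          · simp only
            rw [← hgx, TO_dotProduct hg, hG, hgx]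
        | zero => simp
        | add a b _ _ ha hb => rw [dotProduct_add, dotProduct_add, ha, hb]
        | smul c a _ ha => rw [dotProduct_smul, dotProduct_smul, ha])
      refine ⟨g' * g, mul_mem hg' hg, fun i => ?_⟩
      rw [← mulVec_mulVec]
      refine Fin.cases hgx' (fun i => ?_) i
      rw [hgx]
      exact hgW' _ (Submodule.subset_span (Set.mem_insert_of_mem _ ⟨i, rfl⟩))

/-- Witt's extension theorem for matrices: the families are the columns. -/
theorem exists_TO_mul {n k : ℕ} (X Y : Matrix (Fin n) (Fin k) (ZMod 2)) (hG : Xᵀ * X = Yᵀ * Y)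
    (hR : ∀ (c : Fin k → ZMod 2) (e : ZMod 2), X *ᵥ c = e • 1 ↔ Y *ᵥ c = e • 1) :
    ∃ g ∈ Matrix.orthogonalGroup (Fin n) (ZMod 2), g * X = Y := by
  have hsum : ∀ (Z : Matrix (Fin n) (Fin k) (ZMod 2)) (c : Fin k → ZMod 2),
      ∑ i, c i • Zᵀ i = Z *ᵥ c := fun Z c => by
    ext j; simp [mulVec, dotProduct, mul_comm]
  obtain ⟨g, hg, h⟩ := exists_TO_family k Xᵀ Yᵀ (fun i j => congrFun (congrFun hG i) j)
    (fun c e => by rw [hsum, hsum]; exact hR c e)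
  exact ⟨g, hg, by ext i j; exact congrFun (h j) i⟩

/-! ### Orthonormal families and Albert's theorem -/

theorem eq_one_of_ne_zero : ∀ {c : ZMod 2}, c ≠ 0 → c = 1 := by decide

theorem dotProduct_mulVec_symm {n : ℕ} {N : Mat n} (hN : Nᵀ = N) (v w : Fin n → ZMod 2) :
    v ⬝ᵥ N *ᵥ w = w ⬝ᵥ N *ᵥ v := by
  rw [dotProduct_mulVec, ← mulVec_transpose, hN, dotProduct_comm]

/-- The families `p` that are orthonormal for the bilinear form with matrix `N`. -/
def IsOrthonormal {n k : ℕ} (N : Mat n) (p : Fin k → Fin n → ZMod 2) : Prop :=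
  ∀ i j, p i ⬝ᵥ N *ᵥ p j = if i = j then 1 else 0

theorem IsOrthonormal.cons {n k : ℕ} {N : Mat n} (hN : Nᵀ = N) {p : Fin k → Fin n → ZMod 2}
    (hp : IsOrthonormal N p) {v : Fin n → ZMod 2} (hv : v ⬝ᵥ N *ᵥ v = 1)
    (hvp : ∀ i, p i ⬝ᵥ N *ᵥ v = 0) : IsOrthonormal N (Fin.cons v p : Fin (k + 1) → _) := by
  intro i j
  refine Fin.cases ?_ (fun i => ?_) i <;> refine Fin.cases ?_ (fun j => ?_) j
  · simpa using hv
  · simpa [(Fin.succ_ne_zero j).symm] using (dotProduct_mulVec_symm hN _ _).trans (hvp j)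
  · simpa using hvp i
  · simpa using hp i j

theorem isOrthonormal_iff {n k : ℕ} {N : Mat n} {p : Fin k → Fin n → ZMod 2} :
    IsOrthonormal N p ↔ of p * N * (of p)ᵀ = 1 := by
  have h : ∀ i j, (of p * N * (of p)ᵀ) i j = p i ⬝ᵥ N *ᵥ p j := fun i j => by
    rw [Matrix.mul_assoc]
    simp [mul_apply, mulVec, dotProduct]
  constructor
  · intro hp
    ext i j
    rw [h, hp, one_apply]
  · intro hp i j
    rw [← h, hp, one_apply]

theorem IsOrthonormal.card_le {n k : ℕ} {N : Mat n} {p : Fin k → Fin n → ZMod 2}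
    (hp : IsOrthonormal N p) : k ≤ n := by
  have h := congrArg Matrix.rank (isOrthonormal_iff.1 hp)
  rw [rank_one, Fintype.card_fin] at h
  calc k = (of p * (N * (of p)ᵀ)).rank := by rw [← Matrix.mul_assoc, h]
    _ ≤ n := (rank_mul_le_left _ _).trans (rank_le_width _)

/-- A nonempty orthonormal family whose orthogonal complement is not the radical is not of maximal
size. -/
theorem IsOrthonormal.exists_larger {n k : ℕ} {N : Mat n} (hN : Nᵀ = N)
    {p : Fin (k + 1) → Fin n → ZMod 2} (hp : IsOrthonormal N p) {w : Fin n → ZMod 2}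
    (hw : ∀ i, p i ⬝ᵥ N *ᵥ w = 0) (hNw : N *ᵥ w ≠ 0) :
    ∃ (l : ℕ) (q : Fin (l + 1) → Fin n → ZMod 2), k < l ∧ IsOrthonormal N q := by
  by_cases halt : ∃ v, (∀ i, p i ⬝ᵥ N *ᵥ v = 0) ∧ v ⬝ᵥ N *ᵥ v = 1
  · obtain ⟨v, hvp, hv⟩ := halt
    exact ⟨k + 1, _, Nat.lt_succ_self k, hp.cons hN hv hvp⟩
  push Not at halt
  have halt' : ∀ v, (∀ i, p i ⬝ᵥ N *ᵥ v = 0) → v ⬝ᵥ N *ᵥ v = 0 := fun v hv =>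
    not_not.1 fun h => halt v hv (eq_one_of_ne_zero h)
  obtain ⟨y, hy⟩ : ∃ y, y ⬝ᵥ N *ᵥ w = 1 := by
    obtain ⟨i, hi⟩ := Function.ne_iff.1 hNw
    exact ⟨Pi.single i 1, by rw [single_one_dotProduct]; exact eq_one_of_ne_zero hi⟩
  -- Projecting `y` off the family keeps its pairing with `w`, so `z` and `w` form a hyperbolic pair
  -- in the complement, where the form is now alternating.
  set z := y + ∑ i, (p i ⬝ᵥ N *ᵥ y) • p i with hz
  have hzp : ∀ i, p i ⬝ᵥ N *ᵥ z = 0 := fun i => by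
    rw [hz, mulVec_add, mulVec_sum, dotProduct_add, dotProduct_sum]
    simp only [mulVec_smul, dotProduct_smul, hp i, smul_eq_mul, mul_ite, mul_one, mul_zero,
      Finset.sum_ite_eq, Finset.mem_univ, if_true, ZModModule.add_self]
  have hzw : z ⬝ᵥ N *ᵥ w = 1 := by
    rw [hz, add_dotProduct, sum_dotProduct, hy]
    simp [hw]
  have hwz : w ⬝ᵥ N *ᵥ z = 1 := by rw [dotProduct_mulVec_symm hN, hzw]
  have hz0 := halt' z hzp
  have hw0 := halt' w hw
  have hp0 : p 0 ⬝ᵥ N *ᵥ p 0 = 1 := by simpa using hp 0 0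
  have hwp : w ⬝ᵥ N *ᵥ p 0 = 0 := by rw [dotProduct_mulVec_symm hN, hw]
  have hzp' : z ⬝ᵥ N *ᵥ p 0 = 0 := by rw [dotProduct_mulVec_symm hN, hzp]
  have htail : IsOrthonormal N (fun i : Fin k => p i.succ) := fun i j => by
    simpa using hp i.succ j.succ
  have hp' : ∀ i : Fin k, p i.succ ⬝ᵥ N *ᵥ p 0 = 0 := fun i => by simpa using hp i.succ 0
  have h2 : (1 : ZMod 2) + 1 = 0 := by decide
  -- A unit vector plus a hyperbolic plane has an orthonormal basis: `p 0` is traded for `p 0 + w`,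
  -- `p 0 + z` and `p 0 + w + z`.
  have h1 := htail.cons hN (v := p 0 + w)
    (by simp [mulVec_add, hp0, hw0, hw, hwp]) (fun i => by simp [mulVec_add, hp', hw])
  have h2' := h1.cons hN (v := p 0 + z)
    (by simp [mulVec_add, hp0, hz0, hzp, hzp'])
    (fun i => by
      refine Fin.cases ?_ (fun i => ?_) i
      · simp [mulVec_add, hp0, hwz, hzp, hwp, h2]
      · simp [mulVec_add, hp', hzp])
  have h3 := h2'.cons hN (v := p 0 + w + z)
    (by simp [mulVec_add, hp0, hz0, hzp, hzp', hwp, hw, hwz, hzw, hw0, h2])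
    (fun i => by
      refine Fin.cases ?_ (fun i => ?_) i
      · simp [mulVec_add, hp0, hz0, hzw, hzp, hzp', hw, h2]
      refine Fin.cases ?_ (fun i => ?_) i
      · simp [mulVec_add, hp0, hw0, hw, hwz, hzp, hwp, h2]
      · simp [mulVec_add, hp', hzp, hw])
  exact ⟨k + 2, _, by omega, h3⟩

/-- Albert's theorem: a symmetric matrix over `𝔽₂` with a nonzero diagonal entry is of the form
`X Xᵀ` with `X` left invertible. -/
theorem exists_eq_mul_transpose {n : ℕ} {N : Mat n} (hN : Nᵀ = N) {i₀ : Fin n}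
    (hd : N i₀ i₀ ≠ 0) : ∃ (X : Matrix (Fin n) (Fin N.rank) (ZMod 2))
      (Y : Matrix (Fin N.rank) (Fin n) (ZMod 2)), N = X * Xᵀ ∧ Y * X = 1 := by
  suffices h : ∃ (k : ℕ) (p : Fin k → Fin n → ZMod 2), IsOrthonormal N p ∧
      ∀ w, (∀ i, p i ⬝ᵥ N *ᵥ w = 0) → N *ᵥ w = 0 by
    obtain ⟨k, p, hp, hmax⟩ := h
    have hp' := isOrthonormal_iff.1 hp
    have hfac : N * (of p)ᵀ * (N * (of p)ᵀ)ᵀ = N := by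
      refine ext_of_mulVec_single fun j => ?_
      rw [transpose_mul, transpose_transpose, hN]
      -- The vector `e_j + Pᵀ P N e_j` is orthogonal to the family, hence lies in the radical; this
      -- says `N Pᵀ P N = N` column by column.
      have := hmax (Pi.single j 1 + ((of p)ᵀ * (of p * N)) *ᵥ Pi.single j 1) (fun i => by
        have : of p *ᵥ (N *ᵥ (Pi.single j 1 + ((of p)ᵀ * (of p * N)) *ᵥ Pi.single j 1)) = 0 := by
          rw [mulVec_add, mulVec_add, mulVec_mulVec, mulVec_mulVec, mulVec_mulVec,
            ← Matrix.mul_assoc (of p * N), hp',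
            Matrix.one_mul, ZModModule.add_self]
        exact congrFun this i)
      rw [mulVec_add, mulVec_mulVec] at this
      rw [Matrix.mul_assoc, ← sub_eq_zero, ZModModule.sub_eq_add, add_comm, this]
    have hk : N.rank = k := by
      apply le_antisymm
      · rw [← hfac]
        exact (rank_mul_le_left _ _).trans (rank_le_width _)
      · have h := congrArg Matrix.rank hp'
        rw [rank_one, Fintype.card_fin] at h
        rw [← h]
        exact (rank_mul_le_left _ _).trans (rank_mul_le_right _ _)
    subst hk
    exact ⟨N * (of p)ᵀ, of p, hfac.symm, by rw [← Matrix.mul_assoc, hp']⟩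
  by_contra! hcon
  -- Without a family whose complement is the radical, families grow without bound from `e_{i₀}`,
  -- contradicting `card_le`. The nonzero diagonal entry is what provides the start.
  have hgrow : ∀ j : ℕ, ∃ (k : ℕ) (p : Fin (k + 1) → Fin n → ZMod 2),
      j ≤ k ∧ IsOrthonormal N p := by
    intro j
    induction j with
    | zero =>
      refine ⟨0, fun _ => Pi.single i₀ 1, le_rfl, fun i j => ?_⟩
      simp [Subsingleton.elim (α := Fin 1) i j, eq_one_of_ne_zero hd]
    | succ j ih =>
      obtain ⟨k, p, hjk, hp⟩ := ih
      obtain ⟨w, hw, hNw⟩ := hcon _ p hp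
      obtain ⟨l, q, hl, hq⟩ := hp.exists_larger hN hw hNw
      exact ⟨l, q, by omega, hq⟩
  obtain ⟨k, p, hk, hp⟩ := hgrow n
  have := hp.card_le
  omega

/-! ### Symmetric involutions, mirrors and invariance under conjugation -/

/-- The symmetric involutive matrices, that is, the involutions of the orthogonal group. -/
structure IsSymInv {n : ℕ} (A : Mat n) : Prop where
  symm : Aᵀ = A
  sq : A * A = 1

namespace IsSymInv

variable {n : ℕ} {A : Mat n}

theorem mem_TO (hA : IsSymInv A) : A ∈ Matrix.orthogonalGroup (Fin n) (ZMod 2) := by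
  rw [mem_TO_iff, hA.symm, hA.sq]

theorem of_TO {A : TO n} (hA : IsInvolution A) : IsSymInv (A : Mat n) := by
  have h1 : (A : Mat n)ᵀ * (A : Mat n) = 1 := TO_transpose_mul A.2
  have h2 : (A : Mat n) * (A : Mat n) = 1 := congrArg Subtype.val hA
  refine ⟨?_, h2⟩
  calc (A : Mat n)ᵀ = (A : Mat n)ᵀ * ((A : Mat n) * (A : Mat n)) := by rw [h2, mul_one]
    _ = (A : Mat n) := by rw [← mul_assoc, h1, one_mul]

theorem isInvolution (hA : IsSymInv A) : IsInvolution (⟨A, hA.mem_TO⟩ : TO n) :=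
  Subtype.ext hA.sq

theorem add_one_symm (hA : IsSymInv A) : (A + 1)ᵀ = A + 1 := by
  rw [transpose_add, hA.symm, transpose_one]

theorem add_one_sq (hA : IsSymInv A) : (A + 1) * (A + 1) = 0 := by
  rw [add_mul, mul_add, hA.sq, mul_one, one_mul, add_comm 1 A, ZModModule.add_self]

end IsSymInv

theorem mirror_eq {n : ℕ} (A : Mat n) : mirror A = A + vecMulVec 1 1 := by
  ext i j; simp [mirror, vecMulVec]

theorem mirror_mirror {n : ℕ} (A : Mat n) : mirror (mirror A) = A := by
  rw [mirror_eq, mirror_eq, add_assoc, ZModModule.add_self, add_zero]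

/-- The all-one matrix absorbs `A` on either side, so the two cross terms cancel; its own square
vanishes because `n` is even. -/
theorem IsSymInv.mirror {n : ℕ} (hn : Even n) {A : Mat n} (hA : IsSymInv A) :
    IsSymInv (mirror A) := by
  have h1 := TO_mulVec_one hA.mem_TO
  have h1' : (1 : Fin n → ZMod 2) ᵥ* A = 1 := by rw [← mulVec_transpose, hA.symm, h1]
  have h2 : (1 : Fin n → ZMod 2) ⬝ᵥ 1 = 0 := by
    simpa [dotProduct] using (ZMod.natCast_eq_zero_iff_even).2 hn
  constructor
  · rw [mirror_eq, transpose_add, hA.symm, transpose_vecMulVec]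
  · rw [mirror_eq, add_mul, mul_add, mul_add, hA.sq, mul_vecMulVec, vecMulVec_mul,
      vecMulVec_mul_vecMulVec, h1, h1', h2, zero_smul, vecMulVec_zero, add_zero, add_assoc,
      ZModModule.add_self, add_zero]

theorem mirror_conj {n : ℕ} {g : Mat n} (hg : g ∈ Matrix.orthogonalGroup (Fin n) (ZMod 2))
    (A : Mat n) : mirror (g * A * gᵀ) = g * mirror A * gᵀ := by
  rw [mirror_eq, mirror_eq, mul_add, add_mul, mul_vecMulVec, vecMulVec_mul, TO_mulVec_one hg,
    vecMul_transpose, TO_mulVec_one hg]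

theorem D_conj {n : ℕ} {g : Mat n} (hg : g ∈ Matrix.orthogonalGroup (Fin n) (ZMod 2))
    (A : Mat n) : D (g * A * gᵀ) = D A := by
  have h : g * A * gᵀ + 1 = g * (A + 1) * gᵀ := by
    rw [mul_add, add_mul, mul_one, TO_mul_transpose hg]
  have hu : IsUnit g.det := by
    rw [← isUnit_iff_isUnit_det]
    exact IsUnit.of_mul_eq_one _ (TO_mul_transpose hg)
  unfold D
  rw [h, rank_mul_eq_left_of_isUnit_det _ _ (by rwa [det_transpose]),
    rank_mul_eq_right_of_isUnit_det _ _ hu]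

theorem alpha_conj {n : ℕ} {g : Mat n} (hg : g ∈ Matrix.orthogonalGroup (Fin n) (ZMod 2))
    (A : Mat n) : alpha (g * A * gᵀ) = alpha A := by
  have hsurj : Function.Surjective (gᵀ *ᵥ · : (Fin n → ZMod 2) → _) := fun v =>
    ⟨g *ᵥ v, by simp [mulVec_mulVec, TO_transpose_mul hg]⟩
  have h : (fun v : Fin n → ZMod 2 => v ⬝ᵥ (g * A * gᵀ) *ᵥ v)
      = (fun v => v ⬝ᵥ A *ᵥ v) ∘ (gᵀ *ᵥ ·) := by
    funext v
    simp only [Function.comp_apply]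
    rw [← mulVec_mulVec, ← mulVec_mulVec, dotProduct_mulVec, ← mulVec_transpose]
  unfold alpha
  rw [h, hsurj.range_comp]

theorem DD_conj {n : ℕ} {g : Mat n} (hg : g ∈ Matrix.orthogonalGroup (Fin n) (ZMod 2))
    (A : Mat n) : DD (g * A * gᵀ) = DD A := by
  unfold DD
  rw [mirror_conj hg, D_conj hg, D_conj hg, alpha_conj hg, alpha_conj hg]

theorem isConj_iff_exists {n : ℕ} {A B : TO n} : IsConj A B ↔
    ∃ g ∈ Matrix.orthogonalGroup (Fin n) (ZMod 2), g * (A : Mat n) * gᵀ = B := by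
  rw [isConj_iff]
  constructor
  · rintro ⟨g, h⟩
    exact ⟨g, g.2, congrArg Subtype.val h⟩
  · rintro ⟨g, hg, h⟩
    exact ⟨⟨g, hg⟩, Subtype.ext h⟩

theorem alpha_le_one {n : ℕ} (A : Mat n) : alpha A ≤ 1 :=
  (Submodule.finrank_le _).trans (by simp)

/-- The map `v ↦ v ⬝ A v` is linear, so it vanishes when it vanishes on the standard basis, where
its values are the diagonal entries. -/
theorem alpha_eq_zero_iff {n : ℕ} {A : Mat n} (hA : IsSymInv A) :
    alpha A = 0 ↔ ∀ i, A i i = 0 := by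
  obtain ⟨L, hL, hα⟩ := exists_linear_alpha ⟨A, hA.mem_TO⟩ hA.isInvolution
  have hLi : ∀ i, L (Pi.single i 1) = A i i := fun i => by simp [hL]
  change alpha A = _ at hα
  rw [hα, Submodule.finrank_eq_zero, LinearMap.range_eq_bot]
  constructor
  · intro h i
    rw [← hLi, h, LinearMap.zero_apply]
  · intro h
    refine LinearMap.pi_ext' fun i => LinearMap.ext_ring ?_
    simpa [h] using hLi i

theorem alpha_mirror_eq_zero_iff {n : ℕ} (hn : Even n) {A : Mat n} (hA : IsSymInv A) :
    alpha (mirror A) = 0 ↔ ∀ i, A i i = 1 := by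
  rw [alpha_eq_zero_iff (hA.mirror hn)]
  have h : ∀ c : ZMod 2, c + 1 = 0 ↔ c = 1 := by decide
  simp [mirror, h]

/-! ### The rank of the mirror -/

/-- The range of a symmetric matrix is the orthogonal complement of its kernel. -/
theorem exists_ker_of_notMem_range {n : ℕ} {N : Mat n} (hN : Nᵀ = N) {u : Fin n → ZMod 2}
    (hu : ∀ x, N *ᵥ x ≠ u) : ∃ v, N *ᵥ v = 0 ∧ u ⬝ᵥ v = 1 := by
  obtain ⟨t, ht, htu⟩ := exists_dotProduct_eq_one (LinearMap.range N.mulVecLin) (x := u)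
    (by rintro ⟨x, hx⟩; exact hu x hx)
  refine ⟨t, dotProduct_eq _ _ fun w => ?_, by rw [dotProduct_comm, htu]⟩
  rw [zero_dotProduct, dotProduct_comm, dotProduct_mulVec_symm hN]
  exact ht _ ⟨w, rfl⟩

theorem add_vecMulVec_mulVec {n : ℕ} (N : Mat n) (u x : Fin n → ZMod 2) :
    (N + vecMulVec u u) *ᵥ x = N *ᵥ x + (u ⬝ᵥ x) • u := by
  rw [add_mulVec, vecMulVec_mulVec]
  simp

theorem rank_add_vecMulVec_of_notMem {n : ℕ} {N : Mat n} (hN : Nᵀ = N) {u : Fin n → ZMod 2}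
    (hu : ∀ x, N *ᵥ x ≠ u) : (N + vecMulVec u u).rank = N.rank + 1 := by
  obtain ⟨v, hv, huv⟩ := exists_ker_of_notMem_range hN hu
  have hrange : LinearMap.range (N + vecMulVec u u).mulVecLin
      = LinearMap.range N.mulVecLin ⊔ Submodule.span (ZMod 2) {u} := by
    apply le_antisymm
    · rintro _ ⟨x, rfl⟩
      rw [mulVecLin_apply, add_vecMulVec_mulVec]
      exact Submodule.add_mem_sup ⟨x, rfl⟩ (Submodule.mem_span_singleton.2 ⟨_, rfl⟩)
    · refine sup_le ?_ ((Submodule.span_singleton_le_iff_mem _ _).2 ⟨v, ?_⟩)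
      · rintro _ ⟨x, rfl⟩
        refine ⟨x + (u ⬝ᵥ x) • v, ?_⟩
        rw [mulVecLin_apply, add_vecMulVec_mulVec, mulVec_add, mulVec_smul, hv, dotProduct_add,
          dotProduct_smul, huv]
        simp [ZModModule.add_self]
      · rw [mulVecLin_apply, add_vecMulVec_mulVec, hv, huv, zero_add, one_smul]
  unfold Matrix.rank
  rw [hrange, Submodule.finrank_sup_span_singleton]
  rintro ⟨x, hx⟩
  exact hu x hx

theorem rank_add_vecMulVec_of_dotProduct_eq_zero {n : ℕ} {N : Mat n} {u x : Fin n → ZMod 2}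
    (hx : N *ᵥ x = u) (hux : u ⬝ᵥ x = 0) : (N + vecMulVec u u).rank = N.rank := by
  have hle : ∀ M : Mat n, M *ᵥ x = u → (M + vecMulVec u u).rank ≤ M.rank := fun M hM => by
    refine Submodule.finrank_mono ?_
    rintro _ ⟨y, rfl⟩
    refine ⟨y + (u ⬝ᵥ y) • x, ?_⟩
    rw [mulVecLin_apply, mulVecLin_apply, add_vecMulVec_mulVec, mulVec_add, mulVec_smul, hM]
  refine le_antisymm (hle N hx) ?_
  -- Since `u ⬝ x = 0`, the perturbed matrix also sends `x` to `u`, and perturbing it again gives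
  -- back `N`.
  have h := hle (N + vecMulVec u u) (by rw [add_vecMulVec_mulVec, hx, hux, zero_smul, add_zero])
  rwa [add_assoc, ZModModule.add_self, add_zero] at h

theorem mirror_add_one {n : ℕ} (A : Mat n) : mirror A + 1 = A + 1 + vecMulVec 1 1 := by
  rw [mirror_eq, add_right_comm]

theorem D_mirror_of_notMem {n : ℕ} {A : Mat n} (hA : Aᵀ = A) (h : ∀ x, (A + 1) *ᵥ x ≠ 1) :
    D (mirror A) = D A + 1 := by
  unfold D
  rw [mirror_add_one]
  exact rank_add_vecMulVec_of_notMem (by rw [transpose_add, hA, transpose_one]) h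

theorem D_mirror_of_dotProduct_eq_zero {n : ℕ} {A : Mat n} {x : Fin n → ZMod 2}
    (hx : (A + 1) *ᵥ x = 1) (h : 1 ⬝ᵥ x = 0) : D (mirror A) = D A := by
  unfold D
  rw [mirror_add_one]
  exact rank_add_vecMulVec_of_dotProduct_eq_zero hx h

theorem mirror_symm {n : ℕ} {A : Mat n} (hA : Aᵀ = A) : (mirror A)ᵀ = mirror A := by
  rw [mirror_eq, transpose_add, hA, transpose_vecMulVec]

/-- Here `x` lies in the kernel of `mirror A + 1` and pairs to `1` with the all-one vector, which is
therefore outside the range of `mirror A + 1`. So `mirror A` falls under the case where the rank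
goes up. -/
theorem D_mirror_of_dotProduct_eq_one {n : ℕ} {A : Mat n} (hA : Aᵀ = A) {x : Fin n → ZMod 2}
    (hx : (A + 1) *ᵥ x = 1) (h : 1 ⬝ᵥ x = 1) : D (mirror A) + 1 = D A := by
  have h0 : (mirror A + 1) *ᵥ x = 0 := by
    rw [mirror_add_one, add_vecMulVec_mulVec, hx, h, one_smul, ZModModule.add_self]
  rw [← D_mirror_of_notMem (mirror_symm hA), mirror_mirror]
  intro y hy
  have hs : (mirror A + 1)ᵀ = mirror A + 1 := by rw [transpose_add, mirror_symm hA, transpose_one]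
  have := dotProduct_mulVec_symm hs x y
  rw [hy, h0, dotProduct_zero, dotProduct_comm, h] at this
  exact one_ne_zero this

/-! ### Factorization of involutions -/

/-- The factorizations `A + 1 = X Xᵀ` with `X` left invertible. -/
structure IsFactor {n k : ℕ} (A : Mat n) (X : Matrix (Fin n) (Fin k) (ZMod 2)) : Prop where
  eq : A + 1 = X * Xᵀ
  left_inv : ∃ Y : Matrix (Fin k) (Fin n) (ZMod 2), Y * X = 1

theorem exists_isFactor {n k : ℕ} {A : Mat n} (hA : IsSymInv A) (hk : D A = k)
    (hd : ¬ ∀ i, A i i = 1) : ∃ X : Matrix (Fin n) (Fin k) (ZMod 2), IsFactor A X := by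
  subst hk
  push Not at hd
  obtain ⟨i, hi⟩ := hd
  obtain ⟨X, Y, hX, hY⟩ := exists_eq_mul_transpose hA.add_one_symm (i₀ := i) (by
    have h : ∀ c : ZMod 2, c ≠ 1 → c + 1 ≠ 0 := by decide
    simpa using h _ hi)
  exact ⟨X, hX, Y, hY⟩

namespace IsFactor

variable {n k : ℕ} {A : Mat n} {X : Matrix (Fin n) (Fin k) (ZMod 2)}

theorem mulVec_injective (hX : IsFactor A X) : Function.Injective (X *ᵥ ·) := fun c d h => by
  obtain ⟨Y, hY⟩ := hX.left_inv
  have := congrArg (Y *ᵥ ·) h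
  simpa [mulVec_mulVec, hY] using this

/-- Cancelling the outer factors of `X Xᵀ X Xᵀ = 0` by the left inverse and its transpose leaves `Xᵀ
X`. -/
theorem gram (hX : IsFactor A X) (hA : IsSymInv A) : Xᵀ * X = 0 := by
  obtain ⟨Y, hY⟩ := hX.left_inv
  have hY' : Xᵀ * Yᵀ = 1 := by rw [← transpose_mul, hY, transpose_one]
  have h := hA.add_one_sq
  rw [hX.eq] at h
  calc Xᵀ * X = (Y * X) * (Xᵀ * X) * (Xᵀ * Yᵀ) := by rw [hY, hY', Matrix.one_mul, Matrix.mul_one]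
    _ = Y * (X * Xᵀ * (X * Xᵀ)) * Yᵀ := by simp only [Matrix.mul_assoc]
    _ = 0 := by rw [h, Matrix.mul_zero, Matrix.zero_mul]

/-- As `c² = c`, the diagonal of `X Xᵀ` consists of the row sums of `X`. This is how `alpha` detects
that the coordinate vector of `1` is itself all-one. -/
theorem mulVec_one (hX : IsFactor A X) : X *ᵥ 1 = fun i => A i i + 1 := by
  funext i
  have h := congrFun (congrFun hX.eq i) i
  have hc : ∀ c : ZMod 2, c * c = c := by decide
  simp only [Matrix.add_apply, one_apply_eq, mul_apply, transpose_apply, hc] at h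
  simp [h, mulVec, dotProduct]

theorem mulVec_one_eq_one_iff (hX : IsFactor A X) : X *ᵥ 1 = 1 ↔ ∀ i, A i i = 0 := by
  rw [hX.mulVec_one, funext_iff]
  simp

/-- The correspondence is `c = Xᵀ x`: then `c ⬝ c = x ⬝ X Xᵀ x = x ⬝ 1`, and `Xᵀ` is surjective
because `X` has a left inverse. -/
theorem exists_mulVec_eq_one_iff (hX : IsFactor A X) (e : ZMod 2) :
    (∃ x, (A + 1) *ᵥ x = 1 ∧ 1 ⬝ᵥ x = e) ↔ ∃ c, X *ᵥ c = 1 ∧ c ⬝ᵥ c = e := by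
  obtain ⟨Y, hY⟩ := hX.left_inv
  have hdot : ∀ x, X *ᵥ (Xᵀ *ᵥ x) = 1 → (1 : Fin n → ZMod 2) ⬝ᵥ x = (Xᵀ *ᵥ x) ⬝ᵥ (Xᵀ *ᵥ x) :=
    fun x hx => by
      conv_lhs => rw [← hx]
      rw [dotProduct_comm, dotProduct_mulVec, ← mulVec_transpose]
  constructor
  · rintro ⟨x, hx, hxe⟩
    rw [hX.eq, ← mulVec_mulVec] at hx
    exact ⟨Xᵀ *ᵥ x, hx, by rw [← hdot x hx, hxe]⟩
  · rintro ⟨c, hc, hce⟩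
    have hY' : Xᵀ *ᵥ (Yᵀ *ᵥ c) = c := by
      rw [mulVec_mulVec, ← transpose_mul, hY, transpose_one, one_mulVec]
    refine ⟨Yᵀ *ᵥ c, ?_, ?_⟩
    · rw [hX.eq, ← mulVec_mulVec, hY', hc]
    · rw [hdot _ (by rw [hY', hc]), hY', hce]

theorem D_mirror_of_notMem (hX : IsFactor A X) (hA : IsSymInv A) (h : ∀ c, X *ᵥ c ≠ 1) :
    D (mirror A) = D A + 1 :=
  TopOrth.D_mirror_of_notMem hA.symm fun x hx => by
    obtain ⟨c, hc, _⟩ := (hX.exists_mulVec_eq_one_iff _).1 ⟨x, hx, rfl⟩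
    exact h c hc

theorem D_mirror_of_eq_zero (hX : IsFactor A X) {c : Fin k → ZMod 2}
    (hc : X *ᵥ c = 1) (h : c ⬝ᵥ c = 0) : D (mirror A) = D A := by
  obtain ⟨x, hx, hx0⟩ := (hX.exists_mulVec_eq_one_iff 0).2 ⟨c, hc, h⟩
  exact D_mirror_of_dotProduct_eq_zero hx hx0

theorem D_mirror_of_eq_one (hX : IsFactor A X) (hA : IsSymInv A) {c : Fin k → ZMod 2}
    (hc : X *ᵥ c = 1) (h : c ⬝ᵥ c = 1) : D (mirror A) + 1 = D A := by
  obtain ⟨x, hx, hx1⟩ := (hX.exists_mulVec_eq_one_iff 1).2 ⟨c, hc, h⟩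
  exact D_mirror_of_dotProduct_eq_one hA.symm hx hx1

theorem D_mirror_le (hX : IsFactor A X) (hA : IsSymInv A) {c : Fin k → ZMod 2}
    (hc : X *ᵥ c = 1) : D (mirror A) ≤ D A := by
  by_cases h : c ⬝ᵥ c = 0
  · exact (hX.D_mirror_of_eq_zero hc h).le
  · have := hX.D_mirror_of_eq_one hA hc (eq_one_of_ne_zero h)
    omega

theorem mul_TO (hX : IsFactor A X) {h : Mat k}
    (hh : h ∈ Matrix.orthogonalGroup (Fin k) (ZMod 2)) : IsFactor A (X * h) := by
  obtain ⟨Y, hY⟩ := hX.left_inv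
  refine ⟨?_, hᵀ * Y, ?_⟩
  · rw [transpose_mul, Matrix.mul_assoc, ← Matrix.mul_assoc h, TO_mul_transpose hh,
      Matrix.one_mul, hX.eq]
  · rw [Matrix.mul_assoc, ← Matrix.mul_assoc Y, hY, Matrix.one_mul, TO_transpose_mul hh]

/-- Two factored involutions are conjugate if the all-one vector has the same coordinates. -/
theorem exists_conj {B : Mat n} {X' : Matrix (Fin n) (Fin k) (ZMod 2)} (hX : IsFactor A X)
    (hX' : IsFactor B X') (hA : IsSymInv A) (hB : IsSymInv B)
    (h : ∀ c, X *ᵥ c = 1 ↔ X' *ᵥ c = 1) :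
    ∃ g ∈ Matrix.orthogonalGroup (Fin n) (ZMod 2), g * A * gᵀ = B := by
  obtain ⟨g, hg, hgX⟩ := exists_TO_mul X X' (by rw [hX.gram hA, hX'.gram hB]) (by
    intro c e
    by_cases he : e = 0
    · subst he
      rw [zero_smul, ← mulVec_zero X, hX.mulVec_injective.eq_iff, mulVec_zero, ← mulVec_zero X',
        hX'.mulVec_injective.eq_iff]
    · rw [eq_one_of_ne_zero he, one_smul, h])
  refine ⟨g, hg, ?_⟩
  have key : g * (A + 1) * gᵀ = B + 1 := by
    rw [hX.eq, hX'.eq, ← hgX, transpose_mul]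
    simp only [Matrix.mul_assoc]
  rw [mul_add, add_mul, mul_one, TO_mul_transpose hg] at key
  exact add_right_cancel key

end IsFactor

/-! ### Conjugacy from equality of the invariants -/

/-- Two nonzero vectors with the same square, both or neither of them the all-one vector, are in one
orbit. -/
theorem exists_TO_mulVec {k : ℕ} {c d : Fin k → ZMod 2} (hc0 : c ≠ 0) (hd0 : d ≠ 0)
    (hcd : c ⬝ᵥ c = d ⬝ᵥ d) (h1 : c = 1 ↔ d = 1) :
    ∃ g ∈ Matrix.orthogonalGroup (Fin k) (ZMod 2), g *ᵥ c = d := by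
  by_cases hc1 : c = 1
  · exact ⟨1, one_mem _, by rw [one_mulVec, hc1, h1.1 hc1]⟩
  have hmem : ∀ v : Fin k → ZMod 2, v ≠ 0 → v ≠ 1 → v ∉ Submodule.span (ZMod 2) {1} := by
    intro v hv0 hv1 hv
    obtain ⟨e, rfl⟩ := Submodule.mem_span_singleton.1 hv
    by_cases he : e = 0
    · exact hv0 (by rw [he, zero_smul])
    · exact hv1 (by rw [eq_one_of_ne_zero he, one_smul])
  obtain ⟨g, hg, hgc, -⟩ := exists_TO_fixing (Submodule.span (ZMod 2) {1})
    (Submodule.mem_span_singleton_self 1) (hmem c hc0 hc1) (hmem d hd0 fun h => hc1 (h1.2 h)) (by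
      intro w hw
      obtain ⟨e, rfl⟩ := Submodule.mem_span_singleton.1 hw
      rw [dotProduct_smul, dotProduct_smul, ← dotProduct_self_eq, ← dotProduct_self_eq, hcd])
  exact ⟨g, hg, hgc⟩

theorem DD_eq_iff {m n : ℕ} {A : Mat m} {B : Mat n} : DD A = DD B ↔
    D A = D B ∧ alpha A = alpha B ∧ D (mirror A) = D (mirror B) ∧
      alpha (mirror A) = alpha (mirror B) := by
  simp [DD]

/-- The change in `D` under mirroring tells whether `1` has coordinates and what their square is,
and `alpha` tells whether they are all-one. An orthogonal change of factor then aligns the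
coordinates for `A` and `B`. -/
theorem exists_conj_of_not_alternating {n : ℕ} {A B : Mat n} (hA : IsSymInv A) (hB : IsSymInv B)
    (hdA : ¬ ∀ i, A i i = 1) (hdB : ¬ ∀ i, B i i = 1) (hD : D A = D B)
    (hα : alpha A = alpha B) (hD' : D (mirror A) = D (mirror B)) :
    ∃ g ∈ Matrix.orthogonalGroup (Fin n) (ZMod 2), g * A * gᵀ = B := by
  obtain ⟨X, hX⟩ := exists_isFactor hA rfl hdA
  obtain ⟨X', hX'⟩ := exists_isFactor hB hD.symm hdB
  have h10 : (1 : Fin n → ZMod 2) ≠ 0 := by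
    push Not at hdA
    obtain ⟨i, _⟩ := hdA
    exact fun h => one_ne_zero (congrFun h i)
  by_cases hmem : ∃ c, X *ᵥ c = 1
  · obtain ⟨c, hc⟩ := hmem
    obtain ⟨d, hd⟩ : ∃ d, X' *ᵥ d = 1 := by
      by_contra! hne
      have h1 := hX'.D_mirror_of_notMem hB hne
      have h2 := hX.D_mirror_le hA hc
      omega
    have hcd : c ⬝ᵥ c = d ⬝ᵥ d := by
      by_cases h0 : c ⬝ᵥ c = 0 <;> by_cases h0' : d ⬝ᵥ d = 0
      · rw [h0, h0']
      · have h1 := hX.D_mirror_of_eq_zero hc h0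
        have h2 := hX'.D_mirror_of_eq_one hB hd (eq_one_of_ne_zero h0')
        omega
      · have h1 := hX.D_mirror_of_eq_one hA hc (eq_one_of_ne_zero h0)
        have h2 := hX'.D_mirror_of_eq_zero hd h0'
        omega
      · rw [eq_one_of_ne_zero h0, eq_one_of_ne_zero h0']
    obtain ⟨h, hh, hhc⟩ := exists_TO_mulVec (c := c) (d := d)
      (by rintro rfl; exact h10 (by rw [← hc, mulVec_zero]))
      (by rintro rfl; exact h10 (by rw [← hd, mulVec_zero])) hcd (by
        rw [← hX.mulVec_injective.eq_iff, ← hX'.mulVec_injective.eq_iff]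
        simp only [hc, hd, eq_comm (a := (1 : Fin n → ZMod 2))]
        rw [hX.mulVec_one_eq_one_iff, hX'.mulVec_one_eq_one_iff, ← alpha_eq_zero_iff hA,
          ← alpha_eq_zero_iff hB, hα])
    have hX'' := hX'.mul_TO hh
    refine hX.exists_conj hX'' hA hB fun b => ?_
    have hd' : (X' * h) *ᵥ c = 1 := by rw [← mulVec_mulVec, hhc, hd]
    rw [← hc, hX.mulVec_injective.eq_iff, hc, ← hd', hX''.mulVec_injective.eq_iff]
  · push Not at hmem
    refine hX.exists_conj hX' hA hB fun c => iff_of_false (hmem c) fun hc => ?_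
    have h1 := hX.D_mirror_of_notMem hA hmem
    have h2 := hX'.D_mirror_le hB hc
    omega

theorem exists_conj_of_DD_eq {n : ℕ} (hn : Even n) {A B : Mat n} (hA : IsSymInv A)
    (hB : IsSymInv B) (h : DD A = DD B) :
    ∃ g ∈ Matrix.orthogonalGroup (Fin n) (ZMod 2), g * A * gᵀ = B := by
  obtain ⟨hD, hα, hD', hα'⟩ := DD_eq_iff.1 h
  by_cases hd : ∀ i, A i i = 1
  · have hd' : ∀ i, B i i = 1 := by
      rwa [← alpha_mirror_eq_zero_iff hn hB, ← hα', alpha_mirror_eq_zero_iff hn hA]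
    rcases Nat.eq_zero_or_pos n with rfl | hpos
    -- In dimension zero every diagonal condition is vacuous, so mirroring would not produce a
    -- nonalternating matrix.
    · exact ⟨1, one_mem _, Subsingleton.elim _ _⟩
    have hne : ∀ {C : Mat n}, (∀ i, C i i = 1) → ¬ ∀ i, mirror C i i = 1 := fun {C} hC hm => by
      have h1 := hm ⟨0, hpos⟩
      simp only [mirror, of_apply, hC] at h1
      exact absurd h1 (by decide)
    obtain ⟨g, hg, hgA⟩ := exists_conj_of_not_alternating (hA.mirror hn) (hB.mirror hn) (hne hd)
      (hne hd') hD' hα' (by rw [mirror_mirror, mirror_mirror, hD])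
    refine ⟨g, hg, ?_⟩
    rw [← mirror_mirror (g * A * gᵀ), mirror_conj hg, hgA, mirror_mirror]
  · refine exists_conj_of_not_alternating hA hB hd ?_ hD hα hD'
    rwa [← alpha_mirror_eq_zero_iff hn hB, ← hα', alpha_mirror_eq_zero_iff hn hA]

/-- In even dimension the invariant `DD` separates the conjugacy classes of involutions. -/
theorem isConj_iff_DD_eq {n : ℕ} (hn : Even n) {A B : TO n} (hA : IsInvolution A)
    (hB : IsInvolution B) : IsConj A B ↔ DD (A : Mat n) = DD (B : Mat n) := by
  rw [isConj_iff_exists]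
  constructor
  · rintro ⟨g, hg, h⟩
    rw [← h, DD_conj hg]
  · exact exists_conj_of_DD_eq hn (IsSymInv.of_TO hA) (IsSymInv.of_TO hB)

/-! ### Block diagonal sums -/

theorem rank_fromBlocks_diag {a b : ℕ} (A : Mat a) (B : Mat b) :
    (fromBlocks A 0 0 B).rank = A.rank + B.rank := by
  let e := Pi.basisFun (ZMod 2) (Fin a)
  let f := Pi.basisFun (ZMod 2) (Fin b)
  have h := LinearMap.toMatrix_prodMap e f (toLin e e A) (toLin f f B)
  rw [LinearMap.toMatrix_toLin, LinearMap.toMatrix_toLin] at h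
  rw [← h, rank_eq_finrank_range_toLin _ (e.prod f) (e.prod f), toLin_toMatrix,
    LinearMap.range_prodMap, rank_eq_finrank_range_toLin A e e, rank_eq_finrank_range_toLin B f f,
    ← Module.finrank_prod]
  exact LinearEquiv.finrank_eq
    { toFun := fun x => (⟨x.1.1, x.2.1⟩, ⟨x.1.2, x.2.2⟩)
      invFun := fun y => ⟨(y.1.1, y.2.1), y.1.2, y.2.2⟩
      map_add' := fun _ _ => rfl
      map_smul' := fun _ _ => rfl }

theorem dsum_add_one {a b : ℕ} (A : Mat a) (B : Mat b) :
    dsum A B + 1 = reindex finSumFinEquiv finSumFinEquiv (fromBlocks (A + 1) 0 0 (B + 1)) := by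
  have h : (1 : Mat (a + b)) = reindex finSumFinEquiv finSumFinEquiv 1 := by simp
  rw [h, ← fromBlocks_one, dsum]
  have h2 := fromBlocks_add A 0 0 B 1 0 0 (1 : Mat b)
  rw [add_zero, add_zero] at h2
  rw [← h2]
  rfl

theorem D_dsum {a b : ℕ} (A : Mat a) (B : Mat b) : D (dsum A B) = D A + D B := by
  unfold D
  rw [dsum_add_one, rank_reindex, rank_fromBlocks_diag]

theorem IsSymInv.dsum {a b : ℕ} {A : Mat a} {B : Mat b} (hA : IsSymInv A) (hB : IsSymInv B) :
    IsSymInv (dsum A B) := by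
  constructor
  · rw [TopOrth.dsum, transpose_reindex, fromBlocks_transpose, hA.symm, hB.symm]
    simp
  · rw [TopOrth.dsum, reindex_apply, submatrix_mul_equiv, fromBlocks_multiply, hA.sq, hB.sq]
    simp

theorem dsum_diag_iff {a b : ℕ} {A : Mat a} {B : Mat b} {e : ZMod 2} :
    (∀ i, dsum A B i i = e) ↔ (∀ i, A i i = e) ∧ ∀ i, B i i = e := by
  rw [← finSumFinEquiv.forall_congr_right, Sum.forall]
  simp [dsum]

/-- The all-one vector is the image under `A + 1` of a vector `x` with coordinate sum `e`. -/
def HitsOne {n : ℕ} (A : Mat n) (e : ZMod 2) : Prop := ∃ x, (A + 1) *ᵥ x = 1 ∧ 1 ⬝ᵥ x = e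

theorem dsum_add_one_mulVec {a b : ℕ} (A : Mat a) (B : Mat b) (x : Fin a → ZMod 2)
    (y : Fin b → ZMod 2) : (dsum A B + 1) *ᵥ (Sum.elim x y ∘ finSumFinEquiv.symm)
      = Sum.elim ((A + 1) *ᵥ x) ((B + 1) *ᵥ y) ∘ finSumFinEquiv.symm := by
  rw [dsum_add_one, reindex_apply, submatrix_mulVec_equiv, fromBlocks_mulVec]
  simp [Function.comp_assoc]

theorem HitsOne.dsum {a b : ℕ} {A : Mat a} {B : Mat b} {e f : ZMod 2} (hA : HitsOne A e)
    (hB : HitsOne B f) : HitsOne (dsum A B) (e + f) := by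
  obtain ⟨x, hx, hxe⟩ := hA
  obtain ⟨y, hy, hyf⟩ := hB
  refine ⟨Sum.elim x y ∘ finSumFinEquiv.symm, ?_, ?_⟩
  · rw [dsum_add_one_mulVec, hx, hy]
    funext i
    rcases finSumFinEquiv.symm i with j | j <;> simp
  · rw [← hxe, ← hyf]
    simp only [dotProduct, Pi.one_apply, one_mul]
    rw [← finSumFinEquiv.sum_comp, Fintype.sum_sum_type]
    simp

/-- Failure in the first block alone makes the whole sum miss `1`; this is used with an identity
block. -/
theorem HitsOne.of_dsum {a b : ℕ} {A : Mat a} {B : Mat b} {e : ZMod 2}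
    (h : HitsOne (TopOrth.dsum A B) e) : ∃ f, HitsOne A f := by
  obtain ⟨z, hz, -⟩ := h
  refine ⟨_, fun i => z (finSumFinEquiv (Sum.inl i)), ?_, rfl⟩
  have hz' : z = Sum.elim (fun i => z (finSumFinEquiv (Sum.inl i)))
      (fun i => z (finSumFinEquiv (Sum.inr i))) ∘ finSumFinEquiv.symm := by
    funext i
    obtain ⟨j, rfl⟩ := finSumFinEquiv.surjective i
    rcases j with j | j <;> simp only [Function.comp_apply, Equiv.symm_apply_apply, Sum.elim_inl,
      Sum.elim_inr]
  rw [hz', dsum_add_one_mulVec] at hz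
  funext i
  simpa only [Function.comp_apply, Equiv.symm_apply_apply, Sum.elim_inl, Pi.one_apply] using
    congrFun hz (finSumFinEquiv (Sum.inl i))

theorem HitsOne.mirror {n : ℕ} {A : Mat n} (hA : Aᵀ = A) (h : ∀ e, ¬ HitsOne A e) :
    HitsOne (mirror A) 1 := by
  obtain ⟨v, hv, hv1⟩ := exists_ker_of_notMem_range (N := A + 1) (u := 1)
    (by rw [transpose_add, hA, transpose_one]) fun x hx => h _ ⟨x, hx, rfl⟩
  refine ⟨v, ?_, hv1⟩
  rw [mirror_add_one, add_vecMulVec_mulVec, hv, hv1, one_smul, zero_add]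

theorem not_hitsOne_one {n : ℕ} (hn : 0 < n) (e : ZMod 2) : ¬ HitsOne (1 : Mat n) e := by
  rintro ⟨x, hx, -⟩
  rw [ZModModule.add_self, zero_mulVec] at hx
  exact zero_ne_one (congrFun hx ⟨0, hn⟩)

theorem D_mirror_of_not_hitsOne {n : ℕ} {A : Mat n} (hA : Aᵀ = A) (h : ∀ e, ¬ HitsOne A e) :
    D (mirror A) = D A + 1 :=
  D_mirror_of_notMem hA fun x hx => h _ ⟨x, hx, rfl⟩

theorem isSymInv_one {n : ℕ} : IsSymInv (1 : Mat n) := ⟨transpose_one, mul_one 1⟩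

theorem D_one {n : ℕ} : D (1 : Mat n) = 0 := by
  rw [D, ZModModule.add_self, rank_zero]

theorem I₂_eq_one : I₂ = 1 := by decide

theorem mirror_I₂ : mirror I₂ = J₂ := by decide

theorem dpow_I₂ (k : ℕ) : dpow I₂ k = 1 := by
  induction k with
  | zero => exact Subsingleton.elim (α := Matrix (Fin 0) (Fin 0) (ZMod 2)) _ _
  | succ k ih =>
    change dsum (dpow I₂ k) I₂ = 1
    rw [ih, I₂_eq_one, dsum, fromBlocks_one]
    simp

theorem isSymInv_J₂ : IsSymInv J₂ := ⟨by decide, by decide⟩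

theorem isSymInv_dpow_J₂ (k : ℕ) : IsSymInv (dpow J₂ k) := by
  induction k with
  | zero => constructor <;> exact Subsingleton.elim (α := Matrix (Fin 0) (Fin 0) (ZMod 2)) _ _
  | succ k ih => exact ih.dsum isSymInv_J₂

theorem D_J₂ : D J₂ = 1 := by
  rw [← mirror_I₂, I₂_eq_one, D_mirror_of_not_hitsOne transpose_one (not_hitsOne_one two_pos),
    D_one]

theorem D_dpow_J₂ (k : ℕ) : D (dpow J₂ k) = k := by
  induction k with
  | zero => exact Nat.le_zero.1 (rank_le_width _)
  | succ k ih =>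
    change D (dsum (dpow J₂ k) J₂) = k + 1
    rw [D_dsum, ih, D_J₂]

theorem hitsOne_J₂ : HitsOne J₂ 1 := by
  rw [← mirror_I₂, I₂_eq_one]
  exact HitsOne.mirror transpose_one (not_hitsOne_one two_pos)

theorem hitsOne_dpow_J₂ (k : ℕ) : HitsOne (dpow J₂ k) k := by
  induction k with
  | zero => exact ⟨0, Subsingleton.elim (α := Fin 0 → ZMod 2) _ _, by simp⟩
  | succ k ih =>
    rw [Nat.cast_succ]
    exact ih.dsum hitsOne_J₂

theorem dpow_J₂_diag (k : ℕ) : ∀ i, dpow J₂ k i i = 0 := by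
  induction k with
  | zero => exact fun i => i.elim0
  | succ k ih => exact dsum_diag_iff.2 ⟨ih, by decide⟩

theorem not_dpow_J₂_diag {k : ℕ} (hk : 0 < k) : ¬ ∀ i, dpow J₂ k i i = 1 := fun h => by
  have h1 := h ⟨0, by omega⟩
  rw [dpow_J₂_diag] at h1
  exact zero_ne_one h1

theorem not_one_diag {n : ℕ} (hn : 0 < n) : ¬ ∀ i, (1 : Mat n) i i = 0 := fun h => by
  simpa using h ⟨0, hn⟩

theorem mirror_diag_iff {n : ℕ} {A : Mat n} {e : ZMod 2} :
    (∀ i, mirror A i i = e) ↔ ∀ i, A i i = e + 1 := by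
  have h : ∀ a e : ZMod 2, a + 1 = e ↔ a = e + 1 := by decide
  simp [mirror, h]

/-! ### The invariants of the representatives -/

/-- The entries of `DD` as natural numbers. -/
noncomputable def invariants {n : ℕ} (A : Mat n) : ℕ × ℕ × ℕ × ℕ :=
  (D A, alpha A, D (mirror A), alpha (mirror A))

theorem DD_eq_iff_invariants {m n : ℕ} {A : Mat m} {B : Mat n} :
    DD A = DD B ↔ invariants A = invariants B := by
  rw [DD_eq_iff]
  simp [invariants]

theorem invariants_resize {a b : ℕ} (h : a = b) (A : Mat a) :
    invariants (resize h A) = invariants A := by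
  subst h; rfl

theorem IsSymInv.resize {a b : ℕ} (h : a = b) {A : Mat a} (hA : IsSymInv A) :
    IsSymInv (resize h A) := by
  subst h; exact hA

theorem alpha_eq_one {n : ℕ} {A : Mat n} (hA : IsSymInv A) (h : ¬ ∀ i, A i i = 0) :
    alpha A = 1 := by
  have h1 := alpha_le_one A
  have h2 := mt (alpha_eq_zero_iff hA).1 h
  omega

theorem alpha_mirror_eq_one {n : ℕ} (hn : Even n) {A : Mat n} (hA : IsSymInv A)
    (h : ¬ ∀ i, A i i = 1) : alpha (mirror A) = 1 := by
  have h1 := alpha_le_one (mirror A)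
  have h2 := mt (alpha_mirror_eq_zero_iff hn hA).1 h
  omega

theorem isSymInv_family1 (n k : ℕ) (h : k ≤ n) : IsSymInv (family1 n k h) := by
  unfold family1
  rw [dpow_I₂]
  exact (isSymInv_one.dsum (isSymInv_dpow_J₂ k)).resize _

theorem isSymInv_family2 (n k : ℕ) (h : k ≤ n) : IsSymInv (family2 n k h) := by
  unfold family2
  rw [dpow_I₂]
  exact ((isSymInv_one.mirror (even_two_mul _)).dsum (isSymInv_dpow_J₂ k)).resize _

theorem isSymInv_family3 (n k : ℕ) (h : k + 1 ≤ n) : IsSymInv (family3 n k h) := by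
  unfold family3
  rw [dpow_I₂]
  exact (((isSymInv_one.dsum (isSymInv_dpow_J₂ k)).mirror
    ((even_two_mul _).add (even_two_mul _))).dsum isSymInv_J₂).resize _

theorem invariants_family1 {n k : ℕ} (h₁ : 1 ≤ k) (h₂ : k + 1 ≤ n) (h : k ≤ n) :
    invariants (family1 n k h) = (k, 1, k + 1, 1) := by
  unfold family1
  rw [invariants_resize, dpow_I₂, invariants]
  have hA : IsSymInv (dsum (1 : Mat (2 * (n - k))) (dpow J₂ k)) :=
    isSymInv_one.dsum (isSymInv_dpow_J₂ k)
  have hnot : ∀ e, ¬ HitsOne (dsum (1 : Mat (2 * (n - k))) (dpow J₂ k)) e := fun e he => by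
    obtain ⟨f, hf⟩ := he.of_dsum
    exact not_hitsOne_one (by omega) f hf
  have hD : D (dsum (1 : Mat (2 * (n - k))) (dpow J₂ k)) = k := by
    rw [D_dsum, D_one, D_dpow_J₂, zero_add]
  rw [D_mirror_of_not_hitsOne hA.symm hnot, hD,
    alpha_eq_one hA fun h => not_one_diag (by omega) (dsum_diag_iff.1 h).1,
    alpha_mirror_eq_one ((even_two_mul _).add (even_two_mul _)) hA
      fun h => not_dpow_J₂_diag (by omega) (dsum_diag_iff.1 h).2]

theorem invariants_family2 {n k : ℕ} (h₂ : k + 1 ≤ n) (h : k ≤ n) :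
    invariants (family2 n k h) = (k + 1, 0, 2 * ((k + 1) / 2), 1) := by
  unfold family2
  rw [invariants_resize, dpow_I₂, invariants]
  set A := dsum (mirror (1 : Mat (2 * (n - k)))) (dpow J₂ k) with hAdef
  have hpos : 0 < 2 * (n - k) := by omega
  have hA : IsSymInv A := (isSymInv_one.mirror (even_two_mul _)).dsum (isSymInv_dpow_J₂ k)
  -- The mirrored identity and each `J₂` contribute `1`, so the parity of `k + 1` decides whether
  -- mirroring lowers `D`; hence the even part `2 * ((k + 1) / 2)`.
  have hhit : HitsOne A (1 + k) :=
    (HitsOne.mirror transpose_one (not_hitsOne_one hpos)).dsum (hitsOne_dpow_J₂ k)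
  have hD : D A = k + 1 := by
    rw [hAdef, D_dsum, D_mirror_of_not_hitsOne transpose_one (not_hitsOne_one hpos), D_one,
      D_dpow_J₂, zero_add, add_comm]
  have hd : ∀ i, A i i = 0 :=
    dsum_diag_iff.2 ⟨mirror_diag_iff.2 fun i => by simp, dpow_J₂_diag k⟩
  have hD' : D (mirror A) = 2 * ((k + 1) / 2) := by
    obtain ⟨x, hx, hx1⟩ := hhit
    have hcast : (1 + k : ZMod 2) = ((k + 1 : ℕ) : ZMod 2) := by push_cast; ring
    rcases Nat.even_or_odd (k + 1) with he | ho
    · rw [D_mirror_of_dotProduct_eq_zero hx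
        (by rw [hx1, hcast, ZMod.natCast_eq_zero_iff_even.2 he]), hD]
      exact (Nat.two_mul_div_two_of_even he).symm
    · have := D_mirror_of_dotProduct_eq_one hA.symm hx
        (by rw [hx1, hcast, ZMod.natCast_eq_one_iff_odd.2 ho])
      have h2 := Nat.two_mul_div_two_add_one_of_odd ho
      omega
  rw [hD, hD', (alpha_eq_zero_iff hA).2 hd,
    alpha_mirror_eq_one ((even_two_mul _).add (even_two_mul _)) hA fun h => by
      have h0 := h ⟨0, by omega⟩
      rw [hd] at h0
      exact zero_ne_one h0]

theorem invariants_family3 {n k : ℕ} (h₁ : 1 ≤ k) (h₂ : k + 2 ≤ n) (h : k + 1 ≤ n) :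
    invariants (family3 n k h) = (k + 2, 1, k + 2, 1) := by
  unfold family3
  rw [invariants_resize, dpow_I₂, invariants]
  set B := dsum (1 : Mat (2 * (n - k - 1))) (dpow J₂ k) with hBdef
  have hB : IsSymInv B := isSymInv_one.dsum (isSymInv_dpow_J₂ k)
  have heven : Even (2 * (n - k - 1) + 2 * k) := (even_two_mul _).add (even_two_mul _)
  have hnot : ∀ e, ¬ HitsOne B e := fun e he => by
    obtain ⟨f, hf⟩ := he.of_dsum
    exact not_hitsOne_one (by omega) f hf
  have hA : IsSymInv (dsum (mirror B) J₂) := (hB.mirror heven).dsum isSymInv_J₂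
  -- Both summands contribute `1`, and `1 + 1 = 0` keeps `D` unchanged under mirroring.
  obtain ⟨x, hx, hx1⟩ := (HitsOne.mirror hB.symm hnot).dsum hitsOne_J₂
  have hD : D (dsum (mirror B) J₂) = k + 2 := by
    rw [D_dsum, D_mirror_of_not_hitsOne hB.symm hnot, hBdef, D_dsum, D_one, D_dpow_J₂, D_J₂,
      zero_add]
  rw [D_mirror_of_dotProduct_eq_zero hx (by rw [hx1]; decide), hD,
    alpha_eq_one hA fun h => by
      have hB1 : ∀ i, B i i = 1 := by simpa using mirror_diag_iff.1 (dsum_diag_iff.1 h).1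
      exact not_dpow_J₂_diag (by omega) (dsum_diag_iff.1 hB1).2,
    alpha_mirror_eq_one (heven.add even_two) hA fun h => by
      have := (dsum_diag_iff.1 h).2
      revert this
      decide]

/-- The entries of `DD` of the representative with a given label. -/
def repInvariants {n : ℕ} : RepIndex n → ℕ × ℕ × ℕ × ℕ
  | .first k _ _ => (k, 1, k + 1, 1)
  | .firstMirror k _ _ => (k + 1, 1, k, 1)
  | .second k _ => (k + 1, 0, 2 * ((k + 1) / 2), 1)
  | .secondMirror k _ => (2 * ((k + 1) / 2), 1, k + 1, 0)
  | .third k _ _ => (k + 2, 1, k + 2, 1)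

theorem invariants_mirror {n : ℕ} {A : Mat n} {a b c d : ℕ} (h : invariants A = (a, b, c, d)) :
    invariants (mirror A) = (c, d, a, b) := by
  simp only [invariants, Prod.mk.injEq] at h ⊢
  rw [mirror_mirror]
  tauto

theorem invariants_rep {n : ℕ} (r : RepIndex n) : invariants (rep r) = repInvariants r := by
  cases r with
  | first k h₁ h₂ => exact invariants_family1 h₁ h₂ (by omega)
  | firstMirror k h₁ h₂ => exact invariants_mirror (invariants_family1 h₁ h₂ (by omega))
  | second k h => exact invariants_family2 h (by omega)
  | secondMirror k h => exact invariants_mirror (invariants_family2 h (by omega))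
  | third k h₁ h₂ => exact invariants_family3 h₁ h₂ (by omega)

theorem isSymInv_rep {n : ℕ} (r : RepIndex n) : IsSymInv (rep r) := by
  cases r with
  | first k h₁ h₂ => exact isSymInv_family1 n k (by omega)
  | firstMirror k h₁ h₂ => exact (isSymInv_family1 n k (by omega)).mirror (even_two_mul n)
  | second k h => exact isSymInv_family2 n k (by omega)
  | secondMirror k h => exact (isSymInv_family2 n k (by omega)).mirror (even_two_mul n)
  | third k h₁ h₂ => exact isSymInv_family3 n k (by omega)

theorem repInvariants_injective (n : ℕ) : Function.Injective (repInvariants (n := n)) := by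
  intro r s h
  cases r <;> cases s <;> simp [repInvariants] at h ⊢ <;> omega

/-! ### Every involution has the invariants of a representative -/

/-- From `(A + 1)² = 0`, twice the rank is at most `2 * n`. -/
theorem D_le {n : ℕ} {A : Mat (2 * n)} (hA : IsSymInv A) : D A ≤ n := by
  have h := rank_add_rank_le_card_of_mul_eq_zero hA.add_one_sq
  rw [Fintype.card_fin] at h
  unfold D
  omega

theorem one_le_D {n : ℕ} {A : Mat n} (hd : ¬ ∀ i, A i i = 1) : 1 ≤ D A := by
  by_contra h
  have h0 : A + 1 = 0 := by
    have h' : Module.finrank (ZMod 2) (LinearMap.range (A + 1).mulVecLin) = 0 := by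
      unfold D Matrix.rank at h
      omega
    rw [Submodule.finrank_eq_zero, LinearMap.range_eq_bot] at h'
    exact ext_of_mulVec_single fun j => by
      rw [zero_mulVec]; exact LinearMap.congr_fun h' (Pi.single j 1)
  have h1 : ∀ c : ZMod 2, c + 1 = 0 → c = 1 := by decide
  exact hd fun i => h1 _ (by simpa using congrFun (congrFun h0 i) i)

theorem invariants_of_diag_eq_zero {n : ℕ} (hn : 1 ≤ n) {A : Mat (2 * n)} (hA : IsSymInv A)
    (hd : ∀ i, A i i = 0) : invariants A = (D A, 0, 2 * (D A / 2), 1) := by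
  have hd1 : ¬ ∀ i, A i i = 1 := fun h => by
    have h0 := h ⟨0, by omega⟩
    rw [hd] at h0
    exact zero_ne_one h0
  obtain ⟨X, hX⟩ := exists_isFactor hA rfl hd1
  have hX1 := hX.mulVec_one_eq_one_iff.2 hd
  have hsq : (1 : Fin (D A) → ZMod 2) ⬝ᵥ 1 = (D A : ZMod 2) := by simp [dotProduct]
  rw [invariants, (alpha_eq_zero_iff hA).2 hd, alpha_mirror_eq_one (even_two_mul n) hA hd1]
  have hD' : D (mirror A) = 2 * (D A / 2) := by
    rcases Nat.even_or_odd (D A) with he | ho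
    · rw [hX.D_mirror_of_eq_zero hX1 (by rw [hsq, ZMod.natCast_eq_zero_iff_even.2 he])]
      exact (Nat.two_mul_div_two_of_even he).symm
    · have h1 := hX.D_mirror_of_eq_one hA hX1 (by rw [hsq, ZMod.natCast_eq_one_iff_odd.2 ho])
      have h2 := Nat.two_mul_div_two_add_one_of_odd ho
      omega
  rw [hD']

/-- In length at most two the only vectors of even weight are zero and possibly the all-one vector.
This gives the bound `1 ≤ k` in the third family. -/
theorem three_le_of_dotProduct_self_eq_zero {k : ℕ} {c : Fin k → ZMod 2} (h0 : c ≠ 0)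
    (h1 : c ≠ 1) (h : c ⬝ᵥ c = 0) : 3 ≤ k := by
  by_contra hk
  have hk' : k < 3 := by omega
  clear hk
  revert c
  interval_cases k <;> decide

/-- A constant diagonal gives the second family or its mirrors. Otherwise the first family, its
mirrors and the third family correspond to `D` rising, falling or staying put under mirroring, and
`D_le` for `A` and its mirror bounds `k`. -/
theorem exists_repInvariants_eq {n : ℕ} (hn : 1 ≤ n) {A : Mat (2 * n)} (hA : IsSymInv A) :
    ∃ r : RepIndex n, repInvariants r = invariants A := by
  have hle := D_le hA
  have hle' := D_le (hA.mirror (even_two_mul n))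
  by_cases hd0 : ∀ i, A i i = 0
  · have hpos := one_le_D (A := A) fun h => by
      have h0 := h ⟨0, by omega⟩
      rw [hd0] at h0
      exact zero_ne_one h0
    refine ⟨.second (D A - 1) (by omega), ?_⟩
    rw [invariants_of_diag_eq_zero hn hA hd0, repInvariants, Nat.sub_add_cancel hpos]
  have hd0' : ¬ ∀ i, mirror A i i = 1 := fun h => hd0 fun i =>
    (mirror_diag_iff.1 h i).trans (by decide)
  have hpos' := one_le_D hd0'
  by_cases hd1 : ∀ i, A i i = 1
  · refine ⟨.secondMirror (D (mirror A) - 1) (by omega), ?_⟩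
    have h := invariants_mirror (invariants_of_diag_eq_zero hn (hA.mirror (even_two_mul n))
      (mirror_diag_iff.2 (by simpa using hd1)))
    rw [mirror_mirror] at h
    rw [h, repInvariants, Nat.sub_add_cancel hpos']
  have hpos := one_le_D hd1
  have hinv : invariants A = (D A, 1, D (mirror A), 1) := by
    rw [invariants, alpha_eq_one hA hd0, alpha_mirror_eq_one (even_two_mul n) hA hd1]
  rw [hinv]
  obtain ⟨X, hX⟩ := exists_isFactor hA rfl hd1
  by_cases hmem : ∃ c, X *ᵥ c = 1
  · obtain ⟨c, hc⟩ := hmem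
    by_cases hcc : c ⬝ᵥ c = 0
    · have h3 : 3 ≤ D A := by
        refine three_le_of_dotProduct_self_eq_zero (c := c) ?_ ?_ hcc
        · rintro rfl
          rw [mulVec_zero] at hc
          exact zero_ne_one (congrFun hc ⟨0, by omega⟩)
        · rintro rfl
          exact hd0 (hX.mulVec_one_eq_one_iff.1 hc)
      refine ⟨.third (D A - 2) (by omega) (by omega), ?_⟩
      rw [repInvariants, hX.D_mirror_of_eq_zero hc hcc, Nat.sub_add_cancel (by omega)]
    · have h := hX.D_mirror_of_eq_one hA hc (eq_one_of_ne_zero hcc)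
      refine ⟨.firstMirror (D (mirror A)) (by omega) (by omega), ?_⟩
      rw [repInvariants, h]
  · push Not at hmem
    have h := hX.D_mirror_of_notMem hA hmem
    refine ⟨.first (D A) (by omega) (by omega), ?_⟩
    rw [repInvariants, h]

/-- The representatives as elements of the orthogonal group. -/
def repTO {n : ℕ} (r : RepIndex n) : TO (2 * n) := ⟨rep r, (isSymInv_rep r).mem_TO⟩

theorem isInvolution_repTO {n : ℕ} (r : RepIndex n) : IsInvolution (repTO r) :=
  (isSymInv_rep r).isInvolution

theorem isConj_repTO_iff {n : ℕ} {A : TO (2 * n)} (hA : IsInvolution A) (r : RepIndex n) :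
    IsConj A (repTO r) ↔ repInvariants r = invariants (A : Mat (2 * n)) := by
  rw [isConj_iff_DD_eq (even_two_mul n) hA (isInvolution_repTO r), DD_eq_iff_invariants,
    ← invariants_rep, eq_comm]
  rfl

theorem existsUnique_isConj_repTO {n : ℕ} (hn : 1 ≤ n) {A : TO (2 * n)} (hA : IsInvolution A) :
    ∃! r : RepIndex n, IsConj A (repTO r) := by
  obtain ⟨r, hr⟩ := exists_repInvariants_eq hn (IsSymInv.of_TO hA)
  refine ⟨r, (isConj_repTO_iff hA r).2 hr, fun s hs => ?_⟩
  exact repInvariants_injective n (((isConj_repTO_iff hA s).1 hs).trans hr.symm)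

/-! ### The number of classes -/

/-- The labels, family by family. -/
def repIndexEquiv (n : ℕ) :
    RepIndex n ≃ (Fin (n - 1) ⊕ Fin (n - 1)) ⊕ (Fin n ⊕ Fin n) ⊕ Fin (n - 2) where
  toFun
    | .first k h₁ h₂ => .inl (.inl ⟨k - 1, by omega⟩)
    | .firstMirror k h₁ h₂ => .inl (.inr ⟨k - 1, by omega⟩)
    | .second k h => .inr (.inl (.inl ⟨k, h⟩))
    | .secondMirror k h => .inr (.inl (.inr ⟨k, h⟩))
    | .third k h₁ h₂ => .inr (.inr ⟨k - 1, by omega⟩)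
  invFun
    | .inl (.inl k) => .first (k + 1) (by omega) (by omega)
    | .inl (.inr k) => .firstMirror (k + 1) (by omega) (by omega)
    | .inr (.inl (.inl k)) => .second k k.2
    | .inr (.inl (.inr k)) => .secondMirror k k.2
    | .inr (.inr k) => .third (k + 1) (by omega) (by omega)
  left_inv r := by cases r <;> simp <;> omega
  right_inv r := by rcases r with (r | r) | (r | r) | r <;> simp

/-- The sum is `2(n - 1) + 2n + (n - 2)`. For `n = 1` the last term truncates to zero, leaving two
labels instead of one. -/
theorem card_repIndex {n : ℕ} (hn : 2 ≤ n) : Nat.card (RepIndex n) = 5 * n - 4 := by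
  rw [Nat.card_congr (repIndexEquiv n)]
  simp
  omega

theorem ncard_involutionClasses {n : ℕ} (hn : 2 ≤ n) :
    (involutionClasses (2 * n)).ncard = 5 * n - 4 := by
  have hrange : involutionClasses (2 * n)
      = (fun r : RepIndex n => ConjClasses.mk (repTO r)) '' Set.univ := by
    ext c
    constructor
    · rintro ⟨A, hA, rfl⟩
      obtain ⟨r, hr, -⟩ := existsUnique_isConj_repTO (by omega) hA
      exact ⟨r, Set.mem_univ r, (ConjClasses.mk_eq_mk_iff_isConj.2 hr).symm⟩
    · rintro ⟨r, -, rfl⟩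
      exact ⟨repTO r, isInvolution_repTO r, rfl⟩
  have hinj : Function.Injective fun r : RepIndex n => ConjClasses.mk (repTO r) := by
    intro r s h
    exact (existsUnique_isConj_repTO (by omega) (isInvolution_repTO r)).unique (IsConj.refl _)
      (ConjClasses.mk_eq_mk_iff_isConj.1 h)
  rw [hrange, Set.ncard_image_of_injective _ hinj, Set.ncard_univ, card_repIndex hn]

end TopOrth

theorem theorem1p2 :
    -- (a) in even dimension the DD-invariant separates the conjugacy classes of involutions
    (∀ n : ℕ, Even n → ∀ A B : TopOrth.TO n,
      TopOrth.IsInvolution A → TopOrth.IsInvolution B →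
        (IsConj A B ↔ TopOrth.DD (A : TopOrth.Mat n) = TopOrth.DD (B : TopOrth.Mat n))) ∧
    -- (b) the number of classes
    (∀ n : ℕ, 2 ≤ n → (TopOrth.involutionClasses (2 * n)).ncard = 5 * n - 4) ∧
    -- (b) the listed matrices are involutions in `TO (2n)`, and every involution is conjugate
    -- to exactly one of them
    (∀ n : ℕ, 1 ≤ n →
      ∃ R : TopOrth.RepIndex n → TopOrth.TO (2 * n),
        (∀ r, (R r : TopOrth.Mat (2 * n)) = TopOrth.rep r) ∧
        (∀ r, TopOrth.IsInvolution (R r)) ∧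
        ∀ A : TopOrth.TO (2 * n), TopOrth.IsInvolution A → ∃! r, IsConj A (R r)) := by
  exact ⟨fun n hn A B hA hB => TopOrth.isConj_iff_DD_eq hn hA hB,
    fun n hn => TopOrth.ncard_involutionClasses hn,
    fun n hn => ⟨TopOrth.repTO, fun _ => rfl, TopOrth.isInvolution_repTO,
      fun A hA => TopOrth.existsUnique_isConj_repTO hn hA⟩⟩
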